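/- Let $l\ge 2$ and let $\Phi=\{\phi_i\}_{i=1}^l$ be an iterated function system of contracting similarities of the Euclidean plane, $\phi_i(z)=\alpha_iO_iz+t_i$ with $0<|\alpha_i|<1$, $O_i\in O(\mathbb R^2)$ (the orthogonal part of $\phi_i$) and $t_i\in\mathbb R^2$. Let $F$ be its attractor, i.e. the unique nonempty compact set with $F=\bigcup_i\phi_i(F)$, and let $G_\Phi\le O(\mathbb R^2)$ be the group generated by $O_1,\dots,O_l$. $\Phi$ satisfies the strong separation condition (SSC) if $\phi_i(F)\cap\phi_j(F)=\emptyset$ for all $i\ne j$. Let $\mu$ be a self-similar measure with respect to $\Phi$, i.e. a Borel probability measure on $\mathbb R^2$ with $\mu=\sum_{i=1}^l p_i\,\mu\circ\phi_i^{-1}$ for some $p_1,\dots,p_l>0$ with $\sum_i p_i=1$. A Borel probability measure $\nu$ on $\mathbb R^2$ is exact dimensional of dimension $s$ if $\lim_{r\to0^+}\log\nu(B(x,r))/\log r=s$ for $\nu$-a.e. $x$. We say that $\mu$ admits a $1$-slicing if there is a one-dimensional linear subspace $V\subset\mathbb R^2$ such that (i) $O_i(V)=V$ for every $i$, and (ii)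 for $P_{V^\perp}\mu$-a.e. $y\in V^\perp$, the conditional measure of $\mu$ on the translate $V+y$, obtained by disintegrating $\mu$ along the orthogonal projection $P_{V^\perp}:\mathbb R^2\to V^\perp$, is exact dimensional of dimension $1$. Then: 1. If $|G_\Phi|\ge 5$ or $|G_\Phi\cap SO(\mathbb R^2)|>2$ (infinite cardinalities allowed), then $\mu$ does not admit a $1$-slicing. 2. If $\Phi$ satisfies the SSC, then $\mu$ does not admit a $1$-slicing. -/

import Mathlib

open MeasureTheory ProbabilityTheory Filter Topology
open scoped NNReal

/-- The Euclidean plane. -/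
abbrev Plane : Type := EuclideanSpace ℝ (Fin 2)

/-- The orthogonal group of the plane, under composition. -/
abbrev PlaneOrthogonal : Type := Plane ≃ₗᵢ[ℝ] Plane

/-- The group of rotations, i.e. orthogonal maps of determinant one. -/
noncomputable def planeRotations : Subgroup PlaneOrthogonal where
  carrier := {O | LinearMap.det (O.toLinearEquiv : Plane →ₗ[ℝ] Plane) = 1}
  mul_mem' := by
    intro a b ha hb
    simp only [Set.mem_ofPred_eq] at ha hb ⊢
    have h : ((a * b).toLinearEquiv : Plane →ₗ[ℝ] Plane)
        = (a.toLinearEquiv : Plane →ₗ[ℝ] Plane) * (b.toLinearEquiv : Plane →ₗ[ℝ] Plane) := rfl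
    rw [h, map_mul, ha, hb, one_mul]
  one_mem' := by
    simp only [Set.mem_ofPred_eq]
    have h : ((1 : PlaneOrthogonal).toLinearEquiv : Plane →ₗ[ℝ] Plane) = 1 := rfl
    rw [h, map_one]
  inv_mem' := by
    intro a ha
    simp only [Set.mem_ofPred_eq] at ha ⊢
    have h : (a⁻¹.toLinearEquiv : Plane →ₗ[ℝ] Plane) * (a.toLinearEquiv : Plane →ₗ[ℝ] Plane)
        = 1 := by
      ext1 x
      exact a.symm_apply_apply x
    have h2 := congrArg LinearMap.det h
    rw [map_mul, ha, mul_one, map_one] at h2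
    exact h2

/-- An iterated function system of `l ≥ 2` contracting similarities
`z ↦ α i • O i z + t i` of the plane, with `α i ≠ 0`, `|α i| < 1` and `O i` orthogonal. -/
structure SimilarityIFS (l : ℕ) where
  two_le : 2 ≤ l
  ratio : Fin l → ℝ
  orth : Fin l → PlaneOrthogonal
  trans : Fin l → Plane
  ratio_ne_zero : ∀ i, ratio i ≠ 0
  abs_ratio_lt_one : ∀ i, |ratio i| < 1

namespace SimilarityIFS

variable {l : ℕ}

/-- The `i`-th similarity of the system. -/
noncomputable def toMap (Φ : SimilarityIFS l) (i : Fin l) (z : Plane) : Plane :=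
  Φ.ratio i • Φ.orth i z + Φ.trans i

/-- `F` is the attractor of `Φ` (the unique nonempty compact set with `F = ⋃ φ_i(F)`). -/
def IsAttractor (Φ : SimilarityIFS l) (F : Set Plane) : Prop :=
  F.Nonempty ∧ IsCompact F ∧ F = ⋃ i, Φ.toMap i '' F

/-- Strong separation condition: the sets `φ_i(F)`, with `F` the attractor, are pairwise
disjoint. -/
def SSC (Φ : SimilarityIFS l) : Prop :=
  ∃ F : Set Plane, Φ.IsAttractor F ∧
    ∀ i j, i ≠ j → Disjoint (Φ.toMap i '' F) (Φ.toMap j '' F)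

/-- The group generated by the orthogonal parts of the maps of `Φ`. -/
noncomputable def orthGroup (Φ : SimilarityIFS l) : Subgroup PlaneOrthogonal :=
  Subgroup.closure (Set.range Φ.orth)

/-- `μ` is a self similar measure with respect to `Φ`: a Borel probability measure with
`μ = ∑ p i • (φ_i)_* μ` for some probability vector `p` with positive entries. -/
def IsSelfSimilarMeasure (Φ : SimilarityIFS l) (μ : Measure Plane) : Prop :=
  IsProbabilityMeasure μ ∧
    ∃ p : Fin l → ℝ≥0, (∀ i, 0 < p i) ∧ ∑ i, p i = 1 ∧
      μ = ∑ i, p i • μ.map (Φ.toMap i)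

end SimilarityIFS

/-- `ν` is exact dimensional, of dimension `s`: its local dimension exists and equals `s` at
`ν`-almost every point. -/
def IsExactDimensional (ν : Measure Plane) (s : ℝ) : Prop :=
  ∀ᵐ x ∂ν, Tendsto (fun r : ℝ => Real.log (ν.real (Metric.closedBall x r)) / Real.log r)
    (𝓝[>] 0) (𝓝 s)

/-- The conditional measures of `μ` on the translates of `V`: the disintegration of `μ` along
the orthogonal projection onto `Vᗮ`, as a Markov kernel from `Vᗮ` to the plane. -/
noncomputable def sliceMeasure (μ : Measure Plane) [IsFiniteMeasure μ]
    (V : Submodule ℝ Plane) : Kernel Vᗮ Plane :=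
  condDistrib id (Vᗮ.orthogonalProjectionOnto) μ

/-- `μ` admits a 1-slicing (as a measure associated with `Φ`): there is a line `V` through the
origin, invariant under all orthogonal parts of maps of `Φ`, such that almost all conditional
measures of `μ` on translates of `V` are exact dimensional of dimension one. -/
def AdmitsOneSlicing {l : ℕ} (Φ : SimilarityIFS l) (μ : Measure Plane) [IsFiniteMeasure μ] :
    Prop :=
  ∃ V : Submodule ℝ Plane, Module.finrank ℝ V = 1 ∧
    (∀ i, V.map ((Φ.orth i).toLinearEquiv : Plane →ₗ[ℝ] Plane) = V) ∧
    ∀ᵐ y ∂(μ.map (Vᗮ.orthogonalProjectionOnto)), IsExactDimensional (sliceMeasure μ V y) 1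

/-!
An isometry of the plane preserving a line acts by a sign on the line and by a sign on its
orthogonal complement. A group of such isometries has at most four elements, and `1` and `-1` are
the only possible rotations in it.

Under strong separation the attractor is totally disconnected, because a connected subset lies in
a single cylinder of every generation. Hence near each of its points some point of the line
through it in the invariant direction is missed, and by compactness and self-similarity the holes
have size proportional to the scale, uniformly. For some `N` and `C`, every porous slice is
therefore covered, for all `n`, by `C * (N - 1) ^ n` intervals of length about `N ^ (-n)`, which
is incompatible with local dimension one at almost every point.
-/

section LinePreservingIsometries

variable {E : Type*} [NormedAddCommGroup E] [InnerProductSpace ℝ E] {V : Submodule ℝ E}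

/-- The stabilizer of the subspace `V` in the orthogonal group of `E`. -/
def submoduleStabilizer (V : Submodule ℝ E) : Subgroup (E ≃ₗᵢ[ℝ] E) where
  carrier := {g | V.map (g.toLinearEquiv : E →ₗ[ℝ] E) = V}
  mul_mem' {g h} hg hh :=
    (Submodule.map_comp (h.toLinearEquiv : E →ₗ[ℝ] E) (g.toLinearEquiv : E →ₗ[ℝ] E) V).trans
      ((congrArg _ hh).trans hg)
  one_mem' := Submodule.map_id V
  inv_mem' {g} hg := (Submodule.map_equiv_eq_comap_symm g.toLinearEquiv.symm V).trans <| by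
    conv_lhs => rw [← show V.map (g.toLinearEquiv : E →ₗ[ℝ] E) = V from hg]
    exact Submodule.comap_map_eq_of_injective g.injective V

lemma submoduleStabilizer_le_orthogonal (V : Submodule ℝ E) :
    submoduleStabilizer V ≤ submoduleStabilizer Vᗮ := fun g hg =>
  (V.map_orthogonal_equiv g).trans (congrArg _ hg)

lemma exists_units_smul_eq_of_mem_submoduleStabilizer_span {u : E} (hu : ‖u‖ = 1)
    {g : E ≃ₗᵢ[ℝ] E} (hg : g ∈ submoduleStabilizer (Submodule.span ℝ {u})) :
    ∃ ε : ℤˣ, g u = ε • u := by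
  have hgu : g u ∈ Submodule.span ℝ {u} :=
    hg.le (Submodule.mem_map_of_mem (Submodule.mem_span_singleton_self u))
  obtain ⟨c, hc⟩ := Submodule.mem_span_singleton.1 hgu
  have habs : |c| = 1 := by
    rw [← Real.norm_eq_abs, ← mul_one ‖c‖, ← hu, ← norm_smul, hc, g.norm_map, hu]
  rcases eq_or_eq_neg_of_abs_eq habs with rfl | rfl
  · exact ⟨1, by rw [← hc, one_smul, one_smul]⟩
  · exact ⟨-1, by rw [← hc, neg_smul, one_smul, Units.neg_smul, one_smul]⟩

lemma span_singleton_eq_of_finrank_eq_one (hV : Module.finrank ℝ V = 1) {u : E} (hu : u ≠ 0)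
    (huV : u ∈ V) : Submodule.span ℝ {u} = V :=
  have : FiniteDimensional ℝ V := Module.finite_of_finrank_eq_succ hV
  Submodule.eq_of_le_of_finrank_eq ((Submodule.span_singleton_le_iff_mem u V).2 huV)
    ((finrank_span_singleton hu).trans hV.symm)

lemma exists_norm_eq_one_and_span_singleton_eq (hV : Module.finrank ℝ V = 1) :
    ∃ u : E, ‖u‖ = 1 ∧ Submodule.span ℝ {u} = V := by
  have : Nontrivial V := Module.nontrivial_of_finrank_eq_succ hV
  obtain ⟨u, hu⟩ := exists_norm_eq V zero_le_one
  have hu1 : ‖(u : E)‖ = 1 := hu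
  exact ⟨u, hu1, span_singleton_eq_of_finrank_eq_one hV (norm_ne_zero_iff.1 (by simp [hu1])) u.2⟩

lemma exists_orthonormalBasis_span_eq_and_span_eq_orthogonal (hE : Module.finrank ℝ E = 2)
    (hV : Module.finrank ℝ V = 1) :
    ∃ b : OrthonormalBasis (Fin 2) ℝ E,
      Submodule.span ℝ {b 0} = V ∧ Submodule.span ℝ {b 1} = Vᗮ := by
  have : FiniteDimensional ℝ E := Module.finite_of_finrank_eq_succ hE
  obtain ⟨u, hu, rfl⟩ := exists_norm_eq_one_and_span_singleton_eq hV
  have horth : Orthonormal ℝ (({0} : Set (Fin 2)).domRestrict fun _ => u) :=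
    ⟨fun _ => hu, fun i j hij => absurd (Subsingleton.elim i j) hij⟩
  obtain ⟨b, hb⟩ := horth.exists_orthonormalBasis_extension_of_card_eq (by simp [hE])
  have hb0 : b 0 = u := hb 0 rfl
  refine ⟨b, by rw [hb0], span_singleton_eq_of_finrank_eq_one ?_ (b.orthonormal.ne_zero 1) ?_⟩
  · have := (Submodule.span ℝ {u}).finrank_add_finrank_orthogonal
    omega
  · rw [Submodule.mem_orthogonal_singleton_iff_inner_right, ← hb0]
    exact b.orthonormal.2 zero_ne_one

lemma exists_orthonormalBasis_forall_mem_submoduleStabilizer (hE : Module.finrank ℝ E = 2)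
    (hV : Module.finrank ℝ V = 1) :
    ∃ b : OrthonormalBasis (Fin 2) ℝ E, ∀ g ∈ submoduleStabilizer V,
      ∃ ε : Fin 2 → ℤˣ, ∀ i, g (b i) = ε i • b i := by
  obtain ⟨b, hb0, hb1⟩ := exists_orthonormalBasis_span_eq_and_span_eq_orthogonal hE hV
  refine ⟨b, fun g hg => ?_⟩
  obtain ⟨ε₀, hε₀⟩ := exists_units_smul_eq_of_mem_submoduleStabilizer_span
    (b.orthonormal.1 0) (hb0.symm ▸ hg)
  obtain ⟨ε₁, hε₁⟩ := exists_units_smul_eq_of_mem_submoduleStabilizer_span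
    (b.orthonormal.1 1) (hb1.symm ▸ submoduleStabilizer_le_orthogonal V hg)
  exact ⟨![ε₀, ε₁], Fin.forall_fin_two.2 ⟨hε₀, hε₁⟩⟩

lemma eq_of_apply_orthonormalBasis_eq {ι : Type*} [Fintype ι] (b : OrthonormalBasis ι ℝ E)
    {g h : E ≃ₗᵢ[ℝ] E} (hgh : ∀ i, g (b i) = h (b i)) : g = h :=
  LinearIsometryEquiv.toLinearEquiv_injective <| b.toBasis.ext' fun i => by
    rw [OrthonormalBasis.coe_toBasis]
    exact hgh i

lemma det_eq_prod_of_apply_basis_eq_smul {ι R M : Type*} [Fintype ι] [CommRing R]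
    [AddCommGroup M] [Module R M] (b : Module.Basis ι R M) {f : M →ₗ[R] M} {c : ι → R}
    (hf : ∀ i, f (b i) = c i • b i) : LinearMap.det f = ∏ i, c i := by
  classical
  have hdiag : LinearMap.toMatrix b b f = Matrix.diagonal c := by
    ext i j
    rw [LinearMap.toMatrix_apply, hf, map_smul, b.repr_self, Finsupp.smul_apply,
      Finsupp.single_apply, Matrix.diagonal_apply, smul_eq_mul, mul_ite, mul_one, mul_zero]
    grind
  rw [← LinearMap.det_toMatrix b, hdiag, Matrix.det_diagonal]

lemma card_submoduleStabilizer_le_four (hE : Module.finrank ℝ E = 2)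
    (hV : Module.finrank ℝ V = 1) : ENat.card (submoduleStabilizer V) ≤ 4 := by
  obtain ⟨b, hb⟩ := exists_orthonormalBasis_forall_mem_submoduleStabilizer hE hV
  choose ε hε using fun g : submoduleStabilizer V => hb g g.2
  have hinj : Function.Injective ε := fun g h hgh =>
    Subtype.ext <| eq_of_apply_orthonormalBasis_eq b fun i => by rw [hε, hε, hgh]
  simpa using ENat.card_le_card_of_injective hinj

lemma card_submoduleStabilizer_inf_planeRotations_le_two {V : Submodule ℝ Plane}
    (hV : Module.finrank ℝ V = 1) :
    ENat.card (submoduleStabilizer V ⊓ planeRotations : Subgroup PlaneOrthogonal) ≤ 2 := by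
  obtain ⟨b, hb⟩ :=
    exists_orthonormalBasis_forall_mem_submoduleStabilizer finrank_euclideanSpace_fin hV
  choose ε hε using
    fun g : (submoduleStabilizer V ⊓ planeRotations : Subgroup PlaneOrthogonal) => hb g g.2.1
  have hsign : ∀ g, ε g 1 = ε g 0 := by
    intro g
    have hdet : LinearMap.det (g.1.toLinearEquiv : Plane →ₗ[ℝ] Plane) = 1 := g.2.2
    rw [det_eq_prod_of_apply_basis_eq_smul b.toBasis (c := fun i => ((ε g i : ℤ) : ℝ))
      fun i => by simpa [Units.smul_def, Int.cast_smul_eq_zsmul] using hε g i,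
      Fin.prod_univ_two] at hdet
    have hprod : (ε g 0 * ε g 1 : ℤ) = 1 := by exact_mod_cast hdet
    rw [← Int.units_inv_eq_self (ε g 0)]
    exact eq_inv_of_mul_eq_one_right (Units.ext hprod)
  have hinj : Function.Injective fun g => ε g 0 := fun g h (hgh : ε g 0 = ε h 0) =>
    Subtype.ext <| eq_of_apply_orthonormalBasis_eq b <|
      Fin.forall_fin_two.2 ⟨by rw [hε, hε, hgh], by rw [hε, hε, hsign, hsign, hgh]⟩
  simpa using ENat.card_le_card_of_injective hinj

end LinePreservingIsometries

section CoveringNumbers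

open Metric

variable {X Y : Type*} [PseudoEMetricSpace X] [PseudoEMetricSpace Y] {δ : ℝ≥0}

lemma externalCoveringNumber_union_le (s t : Set X) :
    externalCoveringNumber δ (s ∪ t) ≤ externalCoveringNumber δ s + externalCoveringNumber δ t :=
  ENat.le_iInf₂_add_iInf₂ fun C hC D hD => by
    have hcover : IsCover δ (s ∪ t) (C ∪ D) := by
      rintro x (hx | hx)
      · exact hC.mono Set.subset_union_left hx
      · exact hD.mono Set.subset_union_right hx
    exact hcover.externalCoveringNumber_le_encard.trans (Set.encard_union_le C D)

lemma externalCoveringNumber_biUnion_finset_le {ι : Type*} (I : Finset ι) (s : ι → Set X) :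
    externalCoveringNumber δ (⋃ i ∈ I, s i) ≤ ∑ i ∈ I, externalCoveringNumber δ (s i) := by
  classical
  induction I using Finset.induction_on with
  | empty => simp
  | insert i I hi ih =>
    rw [Finset.set_biUnion_insert, Finset.sum_insert hi]
    exact (externalCoveringNumber_union_le _ _).trans (by gcongr)

lemma externalCoveringNumber_image_le_of_isometry {f : X → Y} (hf : Isometry f) (s : Set X) :
    externalCoveringNumber δ (f '' s) ≤ externalCoveringNumber δ s :=
  le_iInf₂ fun C hC =>
    ((hf.isCover_image_iff C).2 hC).externalCoveringNumber_le_encard.trans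
      (Set.encard_image_le f C)

end CoveringNumbers

section LocalDimension

open Metric
open scoped ENNReal

variable {X : Type*} [PseudoMetricSpace X] [MeasurableSpace X] {ν : Measure X}

lemma measure_le_mul_of_coveringNumber_le {A : Set X} {δ : ℝ≥0} {c : ℕ} {ε : ℝ≥0∞}
    (hc : coveringNumber δ A ≤ c) (hε : ∀ x ∈ A, ν (closedBall x δ) ≤ ε) : ν A ≤ c * ε := by
  obtain ⟨C, hCA, hCfin, hcover, hcard⟩ :=
    exists_set_encard_eq_coveringNumber (ne_top_of_le_ne_top (ENat.natCast_ne_top c) hc)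
  lift C to Finset X using hCfin
  rw [← hcard, Set.encard_coe_eq_coe_finsetCard, Nat.cast_le] at hc
  calc ν A ≤ ν (⋃ x ∈ C, closedBall x δ) := measure_mono hcover.subset_iUnion_closedBall
    _ ≤ ∑ x ∈ C, ν (closedBall x δ) := measure_biUnion_finset_le C _
    _ ≤ ∑ _x ∈ C, ε := Finset.sum_le_sum fun x hx => hε x (hCA hx)
    _ = C.card * ε := by rw [Finset.sum_const, nsmul_eq_mul]
    _ ≤ c * ε := by gcongr

lemma measure_eq_zero_of_tendsto_coveringNumber_mul {K : Set X} (hK : ∀ᵐ x ∂ν, x ∈ K)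
    {δ : ℕ → ℝ≥0} {c : ℕ → ℕ} {ε : ℕ → ℝ≥0∞}
    (hc : ∀ n, externalCoveringNumber (δ n) K ≤ c n)
    (hε : ∀ᵐ x ∂ν, ∀ᶠ n in atTop, ν (closedBall x (2 * δ n)) ≤ ε n)
    (hlim : Tendsto (fun n => c n * ε n) atTop (𝓝 0)) : ν = 0 := by
  let G (m : ℕ) : Set X := {x ∈ K | ∀ n ≥ m, ν (closedBall x (2 * δ n)) ≤ ε n}
  have hG : ∀ m, ν (G m) = 0 := fun m => by
    refine le_antisymm (ge_of_tendsto hlim ?_) zero_le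
    filter_upwards [eventually_ge_atTop m] with n hn
    refine measure_le_mul_of_coveringNumber_le (δ := 2 * δ n)
      ((coveringNumber_two_mul_le_externalCoveringNumber _ _).trans
        ((externalCoveringNumber_mono_set fun x hx => hx.1).trans (hc n))) fun x hx => ?_
    exact_mod_cast hx.2 n hn
  have hcover : ∀ᵐ x ∂ν, x ∈ ⋃ m, G m := by
    filter_upwards [hK, hε] with x hxK hx
    obtain ⟨m, hm⟩ := eventually_atTop.1 hx
    exact Set.mem_iUnion.2 ⟨m, hxK, hm⟩
  refine ae_eq_bot.1 (eventually_false_iff_eq_bot.1 ?_)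
  filter_upwards [hcover, measure_eq_zero_iff_ae_notMem.1 (measure_iUnion_null hG)] with x hx hx'
  exact hx' hx

lemma eventually_measureReal_closedBall_le_rpow {x : X} {d s : ℝ} (hs : s < d)
    (hd : Tendsto (fun r => Real.log (ν.real (closedBall x r)) / Real.log r) (𝓝[>] 0) (𝓝 d)) :
    ∀ᶠ r in 𝓝[>] (0 : ℝ), ν.real (closedBall x r) ≤ r ^ s := by
  filter_upwards [hd.eventually (eventually_gt_nhds hs), Ioo_mem_nhdsGT one_pos]
    with r hr ⟨hr0, hr1⟩
  rcases measureReal_nonneg (μ := ν) (s := closedBall x r) |>.eq_or_lt with hball | hball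
  · rw [← hball]
    positivity
  · rw [lt_div_iff_of_neg (Real.log_neg hr0 hr1)] at hr
    rw [← Real.log_le_log_iff hball (by positivity), Real.log_rpow hr0]
    exact hr.le

lemma tendsto_inv_pow_nhdsGT_zero {b : ℝ} (hb : 1 < b) :
    Tendsto (fun n : ℕ => (b ^ n)⁻¹) atTop (𝓝[>] 0) :=
  tendsto_inv_atTop_nhdsGT_zero.comp (tendsto_pow_atTop_atTop_of_one_lt hb)

lemma tendsto_mul_pow_mul_rpow_inv_pow {M b s : ℝ} (hM : 0 ≤ M) (hb : 0 < b) (hMb : M < b ^ s)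
    (C : ℝ) {c : ℝ} (hc : 0 ≤ c) :
    Tendsto (fun n : ℕ => C * M ^ n * (c * (b ^ n)⁻¹) ^ s) atTop (𝓝 0) := by
  have hquot : Tendsto (fun n : ℕ => C * c ^ s * (M / b ^ s) ^ n) atTop (𝓝 (C * c ^ s * 0)) :=
    (tendsto_pow_atTop_nhds_zero_of_lt_one (by positivity)
      ((div_lt_one (by positivity)).2 hMb)).const_mul _
  rw [mul_zero] at hquot
  refine hquot.congr fun n => ?_
  rw [Real.mul_rpow hc (by positivity), Real.inv_rpow (by positivity), ← Real.rpow_pow_comm hb.le,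
    div_pow]
  ring

lemma not_isExactDimensional_of_externalCoveringNumber_le {ν : Measure Plane} [IsFiniteMeasure ν]
    [NeZero ν] {K : Set Plane} (hK : ∀ᵐ x ∂ν, x ∈ K) {d : ℝ} {b : ℝ≥0} (hb : 1 < b) {C M : ℕ}
    (hM : (M : ℝ) < b ^ d)
    (hcov : ∀ n : ℕ, externalCoveringNumber (b ^ n)⁻¹ K ≤ (C * M ^ n : ℕ)) :
    ¬ IsExactDimensional ν d := by
  intro hdim
  have hb' : (1 : ℝ) < b := hb
  have hb0 : (0 : ℝ) < b := one_pos.trans hb'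
  obtain ⟨s, hsd, hMs⟩ :=
    ((Real.continuousAt_const_rpow hb0.ne').eventually_const_lt hM).exists_lt
  refine NeZero.ne ν (measure_eq_zero_of_tendsto_coveringNumber_mul hK
    (ε := fun n => ENNReal.ofReal ((2 * ((b : ℝ) ^ n)⁻¹) ^ s)) hcov ?_ ?_)
  · filter_upwards [hdim] with x hx
    filter_upwards [(tendsto_inv_pow_nhdsGT_zero hb').eventually (eventually_nhdsGT_zero_mul_left
      two_pos (eventually_measureReal_closedBall_le_rpow hsd hx))] with n hn
    exact (ENNReal.le_ofReal_iff_toReal_le (measure_ne_top _ _) (by positivity)).2 (mod_cast hn)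
  · have hreal := ENNReal.tendsto_ofReal
      (tendsto_mul_pow_mul_rpow_inv_pow (Nat.cast_nonneg M) hb0 hMs C zero_le_two)
    rw [ENNReal.ofReal_zero] at hreal
    refine hreal.congr fun n => ?_
    rw [ENNReal.ofReal_mul (by positivity)]
    norm_cast

end LocalDimension

section Porosity

variable {E : Type*} [NormedAddCommGroup E] [NormedSpace ℝ E] {V : Submodule ℝ E} {F : Set E}

/-- The set `F` misses the open ball of radius `δ` around some point of `x + V` at distance at
most `r` from `x`. -/
def HasHoleAlong (V : Submodule ℝ E) (F : Set E) (x : E) (r δ : ℝ) : Prop :=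
  ∃ v ∈ V, ‖v‖ ≤ r ∧ ∀ y ∈ F, δ ≤ dist (x + v) y

/-- Uniform porosity of `F` in the directions of `V`, with porosity constant `κ`, at the scales
`r ≤ 1`. -/
def IsPorousAlong (V : Submodule ℝ E) (F : Set E) (κ : ℝ) : Prop :=
  ∀ x ∈ F, ∀ r, 0 < r → r ≤ 1 → HasHoleAlong V F x r (κ * r)

lemma HasHoleAlong.mono {x : E} {r r' δ δ' : ℝ} (h : HasHoleAlong V F x r δ) (hr : r ≤ r')
    (hδ : δ' ≤ δ) : HasHoleAlong V F x r' δ' :=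
  let ⟨v, hvV, hvr, hv⟩ := h
  ⟨v, hvV, hvr.trans hr, fun y hy => hδ.trans (hv y hy)⟩

lemma isometry_add_smul {u : E} (hu : ‖u‖ = 1) (w : E) : Isometry fun t : ℝ => w + t • u :=
  Isometry.of_dist_eq fun s t => by
    rw [dist_add_left, dist_eq_norm, ← sub_smul, norm_smul, hu, mul_one, dist_eq_norm]

lemma IsPorousAlong.setOf_add_smul_mem {u : E} (hu : ‖u‖ = 1) {κ : ℝ}
    (hF : IsPorousAlong (Submodule.span ℝ {u}) F κ) (w : E) :
    IsPorousAlong ⊤ {t : ℝ | w + t • u ∈ F} κ := by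
  intro t ht r hr hr1
  obtain ⟨v, hv, hvr, hhole⟩ := hF _ ht r hr hr1
  obtain ⟨c, rfl⟩ := Submodule.mem_span_singleton.1 hv
  refine ⟨c, Submodule.mem_top, by rwa [norm_smul, hu, mul_one] at hvr, fun s hs => ?_⟩
  rw [← (isometry_add_smul hu w).dist_eq, add_smul, ← add_assoc]
  exact hhole _ hs

end Porosity

section PorousSubsetsOfTheLine

open Metric

variable {E : Set ℝ} {κ : ℝ} {N : ℕ}

lemma Ioc_add_nat_mul_eq_biUnion (a : ℝ) {h : ℝ} (hh : 0 ≤ h) (N : ℕ) :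
    Set.Ioc a (a + N * h) = ⋃ j ∈ Finset.range N, Set.Ioc (a + j * h) (a + j * h + h) := by
  have hmono : Monotone fun j : ℕ => a + j * h := fun i j hij => by dsimp only; gcongr
  have hunion := hmono.biUnion_Ico_Ioc_map_succ 0 N
  simp only [Order.succ_eq_add_one, Nat.cast_add, Nat.cast_one, add_one_mul, ← add_assoc,
    Nat.cast_zero, zero_mul, add_zero] at hunion
  rw [← hunion]
  simp only [Set.mem_Ico, zero_le, true_and, Finset.mem_range]

lemma IsPorousAlong.exists_mem_Ioc_forall_le_dist (hE : IsPorousAlong ⊤ E κ) (hN : 4 ≤ N)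
    (hκN : 4 ≤ κ * N) (a : ℝ) {L : ℝ} (hL0 : 0 < L) (hL1 : L ≤ 1) :
    ∃ z ∈ Set.Ioc a (a + L), ∀ y ∈ E, L / N ≤ dist z y := by
  have hN' : (4 : ℝ) ≤ N := mod_cast hN
  by_cases hmid : ∃ x ∈ E, dist (a + L / 2) x < L / 4
  · obtain ⟨x, hxE, hx⟩ := hmid
    obtain ⟨v, -, hv, hhole⟩ := hE x hxE (L / 4) (by positivity) (by linarith)
    rw [Real.dist_eq, abs_lt] at hx
    obtain ⟨hv1, hv2⟩ := abs_le.1 hv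
    refine ⟨x + v, ⟨by linarith, by linarith⟩, fun y hy => le_trans ?_ (hhole y hy)⟩
    rw [div_le_iff₀ (by positivity)]
    nlinarith
  · push Not at hmid
    refine ⟨a + L / 2, ⟨by linarith, by linarith⟩, fun y hy => le_trans ?_ (hmid y hy)⟩
    gcongr

lemma IsPorousAlong.exists_inter_Ioc_eq_empty (hE : IsPorousAlong ⊤ E κ) (hN : 4 ≤ N)
    (hκN : 4 ≤ κ * N) (a : ℝ) {h : ℝ} (hh : 0 < h) (hh1 : N * h ≤ 1) :
    ∃ j ∈ Finset.range N, E ∩ Set.Ioc (a + j * h) (a + j * h + h) = ∅ := by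
  have hN0 : (0 : ℝ) < N := by positivity
  obtain ⟨z, hz, hzE⟩ := hE.exists_mem_Ioc_forall_le_dist hN hκN a (mul_pos hN0 hh) hh1
  rw [Ioc_add_nat_mul_eq_biUnion a hh.le, Set.mem_iUnion₂] at hz
  obtain ⟨j, hj, hzj⟩ := hz
  refine ⟨j, hj, Set.eq_empty_of_forall_notMem fun y ⟨hyE, hyj⟩ => (hzE y hyE).not_gt ?_⟩
  rw [mul_div_cancel_left₀ _ hN0.ne', Real.dist_eq, abs_lt]
  constructor <;> linarith [hzj.1, hzj.2, hyj.1, hyj.2]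

lemma externalCoveringNumber_inter_Ioc_le_sum (E : Set ℝ) (δ : ℝ≥0) (a : ℝ) {h : ℝ}
    (hh : 0 ≤ h) (N : ℕ) :
    externalCoveringNumber δ (E ∩ Set.Ioc a (a + N * h)) ≤
      ∑ j ∈ Finset.range N,
        externalCoveringNumber δ (E ∩ Set.Ioc (a + j * h) (a + j * h + h)) := by
  rw [Ioc_add_nat_mul_eq_biUnion a hh, Set.inter_iUnion₂]
  exact externalCoveringNumber_biUnion_finset_le _ _

lemma IsPorousAlong.externalCoveringNumber_inter_Ioc_le (hE : IsPorousAlong ⊤ E κ) (hN : 4 ≤ N)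
    (hκN : 4 ≤ κ * N) (n : ℕ) (a : ℝ) {L : ℝ≥0} (hL0 : 0 < L) (hL1 : L ≤ 1) :
    externalCoveringNumber (L / N ^ n) (E ∩ Set.Ioc a (a + L)) ≤ ((N - 1) ^ n : ℕ) := by
  induction n generalizing a L with
  | zero =>
    rw [pow_zero, pow_zero, div_one, Nat.cast_one]
    refine externalCoveringNumber_le_one_of_ediam_le ?_
    refine (ediam_mono Set.inter_subset_right).trans_eq ?_
    rw [Real.ediam_Ioc, add_sub_cancel_left, ENNReal.ofReal_coe_nnreal]
  | succ n ih =>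
    have hN0 : (0 : ℝ≥0) < N := by positivity
    have hcells : (N : ℝ) * (L / N : ℝ≥0) = L := mod_cast mul_div_cancel₀ L hN0.ne'
    have hcell0 : 0 < L / N := by positivity
    have hcell1 : L / N ≤ 1 := (div_le_self zero_le (mod_cast by omega)).trans hL1
    obtain ⟨j, hj, hempty⟩ := hE.exists_inter_Ioc_eq_empty hN hκN a
      (NNReal.coe_pos.2 hcell0) (hcells.trans_le hL1)
    rw [← hcells, pow_succ', ← div_div]
    calc _ ≤ ∑ i ∈ Finset.range N, _ :=
          externalCoveringNumber_inter_Ioc_le_sum E _ a (NNReal.coe_nonneg _) N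
      _ = ∑ i ∈ (Finset.range N).erase j, _ :=
          (Finset.sum_erase _ (by rw [hempty, externalCoveringNumber_empty])).symm
      _ ≤ ∑ i ∈ (Finset.range N).erase j, (((N - 1) ^ n : ℕ) : ℕ∞) :=
          Finset.sum_le_sum fun i _ => ih _ hcell0 hcell1
      _ = ((N - 1) ^ (n + 1) : ℕ) := by
          rw [Finset.sum_const, Finset.card_erase_of_mem hj, Finset.card_range, nsmul_eq_mul,
            pow_succ', Nat.cast_mul]

lemma IsPorousAlong.exists_externalCoveringNumber_le (hE : IsPorousAlong ⊤ E κ) (hκ : 0 < κ)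
    (hbdd : Bornology.IsBounded E) :
    ∃ N C : ℕ, 2 ≤ N ∧
      ∀ n : ℕ, externalCoveringNumber ((N : ℝ≥0) ^ n)⁻¹ E ≤ (C * (N - 1) ^ n : ℕ) := by
  obtain ⟨N, hN⟩ := exists_nat_ge (max 4 (4 / κ))
  have hN4 : 4 ≤ N := mod_cast (le_max_left (4 : ℝ) _).trans hN
  have hκN : 4 ≤ κ * N := (div_le_iff₀' hκ).1 ((le_max_right _ _).trans hN)
  obtain ⟨R, hR⟩ := hbdd.subset_ball 0
  obtain ⟨C, hC⟩ := exists_nat_ge (2 * R)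
  have hsub : E ⊆ Set.Ioc (-R) (-R + C * 1) := by
    refine hR.trans ?_
    rw [Real.ball_eq_Ioo]
    exact Set.Ioo_subset_Ioc_self.trans (Set.Ioc_subset_Ioc (by simp) (by linarith))
  refine ⟨N, C, by omega, fun n => ?_⟩
  rw [← Set.inter_eq_left.2 hsub]
  calc _ ≤ ∑ j ∈ Finset.range C, _ := externalCoveringNumber_inter_Ioc_le_sum E _ (-R) zero_le_one C
    _ ≤ ∑ j ∈ Finset.range C, (((N - 1) ^ n : ℕ) : ℕ∞) := Finset.sum_le_sum fun j _ => by
      simpa using hE.externalCoveringNumber_inter_Ioc_le hN4 hκN n (-R + j * 1)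
        one_pos le_rfl
    _ = (C * (N - 1) ^ n : ℕ) := by
      rw [Finset.sum_const, Finset.card_range, nsmul_eq_mul, Nat.cast_mul]

end PorousSubsetsOfTheLine

section CompactSets

variable {X : Type*} {ι : Type*} [Finite ι] {T : ι → Set X}

lemma exists_subset_of_isPreconnected_of_subset_iUnion [TopologicalSpace X] {s : Set X}
    (hs : IsPreconnected s) (hne : s.Nonempty) (hT : ∀ i, IsClosed (T i))
    (hdisj : Pairwise (Function.onFun Disjoint T)) (hsT : s ⊆ ⋃ i, T i) : ∃ i, s ⊆ T i := by
  obtain ⟨x, hx⟩ := hne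
  obtain ⟨i, hxi⟩ := Set.mem_iUnion.1 (hsT hx)
  have hdisj' : Disjoint (T i) (⋃ j ≠ i, T j) :=
    Set.disjoint_iUnion₂_right.2 fun j hj => hdisj hj.symm
  refine ⟨i, (isPreconnected_iff_subset_of_disjoint_closed.1 hs (T i) (⋃ j ≠ i, T j) (hT i)
    ((Set.toFinite {j | j ≠ i}).isClosed_biUnion fun j _ => hT j) ?_ ?_).resolve_right ?_⟩
  · intro y hy
    obtain ⟨j, hyj⟩ := Set.mem_iUnion.1 (hsT hy)
    rcases eq_or_ne j i with rfl | hji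
    · exact Or.inl hyj
    · exact Or.inr (Set.mem_biUnion hji hyj)
  · rw [hdisj'.inter_eq, Set.inter_empty]
  · exact fun h => Set.disjoint_left.1 hdisj' hxi (h hx)

lemma exists_pos_forall_le_dist_of_pairwise_disjoint [MetricSpace X] (hT : ∀ i, IsCompact (T i))
    (hdisj : Pairwise (Function.onFun Disjoint T)) :
    ∃ c > 0, ∀ i j, i ≠ j → ∀ x ∈ T i, ∀ y ∈ T j, c ≤ dist x y := by
  have hpair : ∀ i j, i ≠ j → ∀ᶠ c in 𝓝[>] (0 : ℝ), ∀ x ∈ T i, ∀ y ∈ T j, c ≤ dist x y := by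
    intro i j hij
    obtain ⟨c, hc, hdist⟩ :=
      Metric.exists_pos_forall_lt_edist (hT i) (hT j).isClosed (hdisj hij)
    filter_upwards [Ioc_mem_nhdsGT (NNReal.coe_pos.2 hc)] with c' hc' x hx y hy
    have hlt := hdist x hx y hy
    rw [edist_nndist, ENNReal.coe_lt_coe] at hlt
    exact hc'.2.trans (NNReal.coe_le_coe.2 hlt.le)
  have hall := eventually_all.2 fun i => eventually_all.2 fun j =>
    eventually_imp_distrib_left.2 (hpair i j)
  exact (hall.and self_mem_nhdsWithin).exists.imp fun c hc => hc.symm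

end CompactSets

section TotallyDisconnectedSets

variable {E : Type*} [NormedAddCommGroup E] [NormedSpace ℝ E] {V : Submodule ℝ E} {F : Set E}

lemma exists_add_notMem_of_isTotallyDisconnected (hF : IsTotallyDisconnected F) (hV : V ≠ ⊥)
    (x : E) {r : ℝ} (hr : 0 < r) : ∃ v ∈ V, ‖v‖ ≤ r ∧ x + v ∉ F := by
  by_contra! hsub
  have : Nontrivial V := Submodule.nontrivial_iff_ne_bot.2 hV
  obtain ⟨v, hv⟩ := exists_norm_eq V hr.le
  have hball : IsPreconnected ((x + ·) '' (Metric.closedBall 0 r ∩ V)) :=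
    ((convex_closedBall _ _).inter V.convex).isPreconnected.image _ (by fun_prop)
  have hsingle : Set.Subsingleton ((x + ·) '' (Metric.closedBall 0 r ∩ V)) := by
    refine hF _ ?_ hball
    rintro _ ⟨w, ⟨hw, hwV⟩, rfl⟩
    exact hsub w hwV (mem_closedBall_zero_iff.1 hw)
  have heq : (v : E) = 0 := (add_right_injective x).subsingleton_image_iff.1 hsingle
    ⟨mem_closedBall_zero_iff.2 hv.le, v.2⟩ ⟨Metric.mem_closedBall_self hr.le, V.zero_mem⟩
  rw [Submodule.coe_norm, heq, norm_zero] at hv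
  exact hr.ne hv

lemma exists_pos_eventually_hasHoleAlong (hF : IsClosed F) {x v : E} {r : ℝ} (hvV : v ∈ V)
    (hvr : ‖v‖ ≤ r) (hxv : x + v ∉ F) : ∃ δ > 0, ∀ᶠ x' in 𝓝 x, HasHoleAlong V F x' r δ := by
  obtain ⟨ε, hε, hball⟩ := Metric.isOpen_iff.1 hF.isOpen_compl (x + v) hxv
  refine ⟨ε / 2, half_pos hε, ?_⟩
  filter_upwards [Metric.ball_mem_nhds x (half_pos hε)] with x' hx'
  refine ⟨v, hvV, hvr, fun y hy => ?_⟩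
  have hfar : ε ≤ dist y (x + v) := not_lt.1 fun hlt => hball hlt hy
  have htri : dist y (x + v) ≤ dist (x' + v) y + dist x' x := by
    simpa only [dist_add_right, dist_comm] using dist_triangle y (x' + v) (x + v)
  linarith [Metric.mem_ball.1 hx']

lemma exists_pos_forall_hasHoleAlong_of_isTotallyDisconnected (hF : IsTotallyDisconnected F)
    (hFc : IsCompact F) (hV : V ≠ ⊥) {r : ℝ} (hr : 0 < r) :
    ∃ δ > 0, ∀ x ∈ F, HasHoleAlong V F x r δ := by
  refine hFc.induction_on (p := fun s => ∃ δ > 0, ∀ x ∈ s, HasHoleAlong V F x r δ)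
    ⟨1, one_pos, by simp⟩ ?_ ?_ ?_
  · rintro s t hst ⟨δ, hδ, ht⟩
    exact ⟨δ, hδ, fun x hx => ht x (hst hx)⟩
  · rintro s t ⟨δ, hδ, hs⟩ ⟨δ', hδ', ht⟩
    exact ⟨min δ δ', lt_min hδ hδ', fun x hx => hx.elim
      (fun h => (hs x h).mono le_rfl (min_le_left _ _))
      fun h => (ht x h).mono le_rfl (min_le_right _ _)⟩
  · intro x _
    obtain ⟨v, hvV, hvr, hxv⟩ := exists_add_notMem_of_isTotallyDisconnected hF hV x hr
    obtain ⟨δ, hδ, hhole⟩ := exists_pos_eventually_hasHoleAlong hFc.isClosed hvV hvr hxv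
    exact ⟨_, mem_nhdsWithin_of_mem_nhds hhole, δ, hδ, fun x' hx' => hx'⟩

end TotallyDisconnectedSets

namespace SimilarityIFS

variable {l : ℕ} {Φ : SimilarityIFS l} {F : Set Plane} {V : Submodule ℝ Plane}

lemma abs_ratio_pos (Φ : SimilarityIFS l) (i : Fin l) : 0 < |Φ.ratio i| :=
  abs_pos.2 (Φ.ratio_ne_zero i)

lemma nonempty_index (Φ : SimilarityIFS l) : Nonempty (Fin l) :=
  ⟨⟨0, two_pos.trans_le Φ.two_le⟩⟩

lemma exists_abs_ratio_le (Φ : SimilarityIFS l) :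
    ∃ ρ : ℝ, 0 < ρ ∧ ρ < 1 ∧ ∀ i, |Φ.ratio i| ≤ ρ := by
  have := Φ.nonempty_index
  obtain ⟨i, hi⟩ := Finite.exists_max fun i => |Φ.ratio i|
  exact ⟨_, Φ.abs_ratio_pos i, Φ.abs_ratio_lt_one i, hi⟩

lemma exists_le_abs_ratio (Φ : SimilarityIFS l) : ∃ a : ℝ, 0 < a ∧ ∀ i, a ≤ |Φ.ratio i| := by
  have := Φ.nonempty_index
  obtain ⟨i, hi⟩ := Finite.exists_min fun i => |Φ.ratio i|
  exact ⟨_, Φ.abs_ratio_pos i, hi⟩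

lemma dist_toMap (Φ : SimilarityIFS l) (i : Fin l) (x y : Plane) :
    dist (Φ.toMap i x) (Φ.toMap i y) = |Φ.ratio i| * dist x y := by
  rw [toMap, toMap, dist_add_right, dist_smul₀, LinearIsometryEquiv.dist_map, Real.norm_eq_abs]

lemma isClosedEmbedding_toMap (Φ : SimilarityIFS l) (i : Fin l) :
    IsClosedEmbedding (Φ.toMap i) :=
  Dilation.isClosedEmbedding (Dilation.mkOfDistEq (Φ.toMap i)
    ⟨‖Φ.ratio i‖₊, nnnorm_ne_zero_iff.2 (Φ.ratio_ne_zero i), Φ.dist_toMap i⟩)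

lemma toMap_add (Φ : SimilarityIFS l) (i : Fin l) (x v : Plane) :
    Φ.toMap i (x + v) = Φ.toMap i x + Φ.ratio i • Φ.orth i v := by
  rw [toMap, toMap, map_add, smul_add, add_right_comm]

lemma norm_ratio_smul_orth (Φ : SimilarityIFS l) (i : Fin l) (v : Plane) :
    ‖Φ.ratio i • Φ.orth i v‖ = |Φ.ratio i| * ‖v‖ := by
  rw [norm_smul, LinearIsometryEquiv.norm_map, Real.norm_eq_abs]

namespace IsAttractor

lemma toMap_mem (hF : Φ.IsAttractor F) (i : Fin l) {x : Plane} (hx : x ∈ F) :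
    Φ.toMap i x ∈ F := by
  rw [hF.2.2]
  exact Set.mem_iUnion.2 ⟨i, x, hx, rfl⟩

lemma exists_toMap_eq (hF : Φ.IsAttractor F) {x : Plane} (hx : x ∈ F) :
    ∃ i, ∃ x' ∈ F, Φ.toMap i x' = x :=
  Set.mem_iUnion.1 (hF.2.2 ▸ hx)

lemma isCompact_image (hF : Φ.IsAttractor F) (i : Fin l) : IsCompact (Φ.toMap i '' F) :=
  hF.2.1.image (Φ.isClosedEmbedding_toMap i).continuous

lemma dist_le_of_isPreconnected (hF : Φ.IsAttractor F)
    (hdisj : Pairwise (Function.onFun Disjoint fun i => Φ.toMap i '' F)) {ρ : ℝ}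
    (hρ : ∀ i, |Φ.ratio i| ≤ ρ) (n : ℕ) :
    ∀ s ⊆ F, IsPreconnected s → ∀ x ∈ s, ∀ y ∈ s, dist x y ≤ ρ ^ n * Metric.diam F := by
  induction n with
  | zero =>
    intro s hsF _ x hx y hy
    simpa only [pow_zero, one_mul] using
      Metric.dist_le_diam_of_mem hF.2.1.isBounded (hsF hx) (hsF hy)
  | succ n ih =>
    intro s hsF hs x hx y hy
    obtain ⟨i, hsi⟩ := exists_subset_of_isPreconnected_of_subset_iUnion hs ⟨x, hx⟩
      (fun i => (hF.isCompact_image i).isClosed) hdisj (hF.2.2 ▸ hsF)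
    obtain ⟨x', -, rfl⟩ := hsi hx
    obtain ⟨y', -, rfl⟩ := hsi hy
    have hpre : IsPreconnected (Φ.toMap i ⁻¹' s) :=
      hs.preimage_of_isClosedMap (Φ.isClosedEmbedding_toMap i).injective
        (Φ.isClosedEmbedding_toMap i).isClosedMap (hsi.trans (Set.image_subset_range _ _))
    have hpreF : Φ.toMap i ⁻¹' s ⊆ F := fun z hz =>
      (Φ.isClosedEmbedding_toMap i).injective.mem_set_image.1 (hsi hz)
    calc dist (Φ.toMap i x') (Φ.toMap i y') = |Φ.ratio i| * dist x' y' := Φ.dist_toMap i x' y'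
      _ ≤ ρ * (ρ ^ n * Metric.diam F) :=
        mul_le_mul (hρ i) (ih _ hpreF hpre x' hx y' hy) dist_nonneg ((abs_nonneg _).trans (hρ i))
      _ = ρ ^ (n + 1) * Metric.diam F := by ring

lemma isTotallyDisconnected (hF : Φ.IsAttractor F)
    (hdisj : Pairwise (Function.onFun Disjoint fun i => Φ.toMap i '' F)) :
    IsTotallyDisconnected F := by
  obtain ⟨ρ, hρ0, hρ1, hρ⟩ := Φ.exists_abs_ratio_le
  intro s hsF hs x hx y hy
  have hlim : Tendsto (fun n : ℕ => ρ ^ n * Metric.diam F) atTop (𝓝 0) := by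
    simpa only [zero_mul] using
      (tendsto_pow_atTop_nhds_zero_of_lt_one hρ0.le hρ1).mul_const (Metric.diam F)
  exact dist_le_zero.1 (ge_of_tendsto' hlim fun n =>
    hF.dist_le_of_isPreconnected hdisj hρ n s hsF hs x hx y hy)

lemma hasHoleAlong_toMap (hF : Φ.IsAttractor F) (hV : ∀ i, ∀ v ∈ V, Φ.orth i v ∈ V) {c : ℝ}
    (hsep : ∀ i j, i ≠ j → ∀ x ∈ Φ.toMap i '' F, ∀ y ∈ Φ.toMap j '' F, c ≤ dist x y) {i : Fin l}
    {x : Plane} (hx : x ∈ F) {r δ : ℝ} (hhole : HasHoleAlong V F x r δ)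
    (hc : |Φ.ratio i| * (r + δ) ≤ c) :
    HasHoleAlong V F (Φ.toMap i x) (|Φ.ratio i| * r) (|Φ.ratio i| * δ) := by
  obtain ⟨v, hvV, hvr, hv⟩ := hhole
  have hnorm : ‖Φ.ratio i • Φ.orth i v‖ ≤ |Φ.ratio i| * r := by
    rw [norm_ratio_smul_orth]
    gcongr
  refine ⟨Φ.ratio i • Φ.orth i v, V.smul_mem _ (hV i v hvV), hnorm, fun y hy => ?_⟩
  obtain ⟨j, y, hyF, rfl⟩ := hF.exists_toMap_eq hy
  rcases eq_or_ne i j with rfl | hij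
  · rw [← toMap_add, dist_toMap]
    gcongr
    exact hv y hyF
  · have hxy := hsep i j hij _ (Set.mem_image_of_mem _ hx) _ (Set.mem_image_of_mem _ hyF)
    have htri := dist_triangle_left (Φ.toMap i x) (Φ.toMap j y)
      (Φ.toMap i x + Φ.ratio i • Φ.orth i v)
    rw [dist_self_add_left] at htri
    linarith

lemma hasHoleAlong_of_forall_mem_Icc (hF : Φ.IsAttractor F)
    (hV : ∀ i, ∀ v ∈ V, Φ.orth i v ∈ V) {c : ℝ}
    (hsep : ∀ i j, i ≠ j → ∀ x ∈ Φ.toMap i '' F, ∀ y ∈ Φ.toMap j '' F, c ≤ dist x y)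
    {a : ℝ} (ha0 : 0 < a) (ha : ∀ i, a ≤ |Φ.ratio i|) {R κ : ℝ} (hR0 : 0 < R) (hRc : 2 * R ≤ c)
    (hκ : κ ≤ 1) (hbase : ∀ x ∈ F, ∀ r ∈ Set.Icc (a * R) R, HasHoleAlong V F x r (κ * r)) :
    ∀ x ∈ F, ∀ r ∈ Set.Ioc 0 R, HasHoleAlong V F x r (κ * r) := by
  obtain ⟨ρ, hρ0, hρ1, hρ⟩ := Φ.exists_abs_ratio_le
  suffices hind : ∀ n : ℕ, ∀ x ∈ F, ∀ r ∈ Set.Icc (ρ ^ n * (a * R)) R,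
      HasHoleAlong V F x r (κ * r) by
    intro x hx r hr
    obtain ⟨n, hn⟩ := exists_pow_lt_of_lt_one (div_pos hr.1 (mul_pos ha0 hR0)) hρ1
    exact hind n x hx r ⟨((lt_div_iff₀ (mul_pos ha0 hR0)).1 hn).le, hr.2⟩
  intro n
  induction n with
  | zero => simpa only [pow_zero, one_mul] using hbase
  | succ n ih =>
    rintro x hx r ⟨hr, hrR⟩
    rcases le_total (a * R) r with har | hra
    · exact hbase x hx r ⟨har, hrR⟩
    obtain ⟨i, x, hxF, rfl⟩ := hF.exists_toMap_eq hx
    have hi := Φ.abs_ratio_pos i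
    obtain ⟨s, rfl⟩ : ∃ s, r = |Φ.ratio i| * s := ⟨r / |Φ.ratio i|, by field_simp⟩
    have hs : ρ ^ n * (a * R) ≤ s := by
      refine le_of_mul_le_mul_left (le_trans ?_ hr) hi
      calc |Φ.ratio i| * (ρ ^ n * (a * R)) ≤ ρ * (ρ ^ n * (a * R)) := by gcongr; exact hρ i
        _ = ρ ^ (n + 1) * (a * R) := by ring
    have hsR : s ≤ R :=
      le_of_mul_le_mul_left (hra.trans (mul_le_mul_of_nonneg_right (ha i) hR0.le)) hi
    have hs0 : 0 ≤ s := le_trans (by positivity) hs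
    rw [mul_left_comm]
    refine hF.hasHoleAlong_toMap hV hsep hxF (ih x hxF s ⟨hs, hsR⟩) ?_
    nlinarith [mul_le_mul_of_nonneg_right hκ (mul_nonneg hi.le hs0)]

lemma exists_isPorousAlong (hF : Φ.IsAttractor F)
    (hdisj : Pairwise (Function.onFun Disjoint fun i => Φ.toMap i '' F)) (hV0 : V ≠ ⊥)
    (hV : ∀ i, ∀ v ∈ V, Φ.orth i v ∈ V) : ∃ κ > 0, IsPorousAlong V F κ := by
  obtain ⟨a, ha0, ha⟩ := Φ.exists_le_abs_ratio
  obtain ⟨c, hc, hsep⟩ := exists_pos_forall_le_dist_of_pairwise_disjoint hF.isCompact_image hdisj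
  set R : ℝ := min 1 (c / 2)
  have hR0 : 0 < R := lt_min one_pos (half_pos hc)
  have hRc : 2 * R ≤ c := by linarith [min_le_right 1 (c / 2)]
  obtain ⟨δ, hδ, hhole⟩ := exists_pos_forall_hasHoleAlong_of_isTotallyDisconnected
    (hF.isTotallyDisconnected hdisj) hF.2.1 hV0 (mul_pos ha0 hR0)
  set κ : ℝ := min 1 (δ / R)
  have hκ0 : 0 < κ := lt_min one_pos (div_pos hδ hR0)
  have hκR : κ * R ≤ δ := (le_div_iff₀ hR0).1 (min_le_right _ _)
  have hscaled := hF.hasHoleAlong_of_forall_mem_Icc hV hsep ha0 ha hR0 hRc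
    (min_le_left _ _ : κ ≤ 1) fun x hx r hr => (hhole x hx).mono hr.1
      ((mul_le_mul_of_nonneg_left hr.2 hκ0.le).trans hκR)
  refine ⟨κ * R, mul_pos hκ0 hR0, fun x hx r hr0 hr1 => ?_⟩
  refine (hscaled x hx (R * r) ⟨mul_pos hR0 hr0, mul_le_of_le_one_right hR0.le hr1⟩).mono
    (mul_le_of_le_one_left hr0.le (min_le_left _ _)) (mul_assoc κ R r).le

end IsAttractor

end SimilarityIFS

section SelfSimilarMeasures

lemma ae_le_zero_of_measure_le_measure_div {α : Type*} [MeasurableSpace α] {μ : Measure α}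
    [IsFiniteMeasure μ] {g : α → ℝ} (hg : Measurable g) {ρ : ℝ} (hρ0 : 0 < ρ) (hρ1 : ρ < 1)
    (hμg : ∀ R > 0, μ {x | R ≤ g x} ≤ μ {x | R / ρ ≤ g x}) : ∀ᵐ x ∂μ, g x ≤ 0 := by
  rw [ae_le_const_iff_forall_gt_measure_zero]
  intro R hR
  have hiter (n : ℕ) : μ {x | R ≤ g x} ≤ μ {x | R / ρ ^ n ≤ g x} := by
    induction n with
    | zero => rw [pow_zero, div_one]
    | succ n ih =>
      rw [pow_succ, ← div_div]
      exact ih.trans (hμg _ (div_pos hR (pow_pos hρ0 n)))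
  have hanti : Antitone fun n : ℕ => {x | R / ρ ^ n ≤ g x} := fun m n hmn x hx =>
    (div_le_div_of_nonneg_left hR.le (pow_pos hρ0 n)
      (pow_le_pow_of_le_one hρ0.le hρ1.le hmn)).trans hx
  have hempty : ⋂ n : ℕ, {x | R / ρ ^ n ≤ g x} = ∅ := by
    rw [Set.eq_empty_iff_forall_notMem]
    intro x hx
    have hgx : 0 < g x := (div_pos hR (pow_pos hρ0 0)).trans_le (Set.mem_iInter.1 hx 0)
    obtain ⟨n, hn⟩ := exists_pow_lt_of_lt_one (div_pos hR hgx) hρ1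
    have hRn : R / ρ ^ n ≤ g x := Set.mem_iInter.1 hx n
    exact hn.not_ge ((div_le_comm₀ (pow_pos hρ0 n) hgx).1 hRn)
  have hlim := tendsto_measure_iInter_atTop (μ := μ)
    (fun n : ℕ => (measurableSet_le measurable_const hg).nullMeasurableSet) hanti
    ⟨0, measure_ne_top μ _⟩
  rw [hempty, measure_empty] at hlim
  exact le_antisymm (ge_of_tendsto' hlim hiter) zero_le

namespace SimilarityIFS

variable {l : ℕ} {Φ : SimilarityIFS l} {F : Set Plane}

lemma IsAttractor.infDist_toMap_le (hF : Φ.IsAttractor F) (i : Fin l) (x : Plane) :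
    Metric.infDist (Φ.toMap i x) F ≤ |Φ.ratio i| * Metric.infDist x F := by
  obtain ⟨y, hy, hxy⟩ := hF.2.1.exists_infDist_eq_dist hF.1 x
  rw [hxy, ← dist_toMap]
  exact Metric.infDist_le_dist_of_mem (hF.toMap_mem i hy)

lemma IsSelfSimilarMeasure.ae_mem_attractor {μ : Measure Plane} (hμ : Φ.IsSelfSimilarMeasure μ)
    (hF : Φ.IsAttractor F) : ∀ᵐ x ∂μ, x ∈ F := by
  obtain ⟨_, p, _, hp1, hμp⟩ := hμ
  obtain ⟨ρ, hρ0, hρ1, hρ⟩ := Φ.exists_abs_ratio_le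
  have hmeas : Measurable fun x => Metric.infDist x F := by fun_prop
  have hpre (R : ℝ) (i : Fin l) : Φ.toMap i ⁻¹' {x | R ≤ Metric.infDist x F} ⊆
      {x | R / ρ ≤ Metric.infDist x F} := fun x hx => (div_le_iff₀' hρ0).2 <|
    hx.trans <| (hF.infDist_toMap_le i x).trans <|
      mul_le_mul_of_nonneg_right (hρ i) Metric.infDist_nonneg
  have hstep (R : ℝ) :
      μ {x | R ≤ Metric.infDist x F} ≤ μ {x | R / ρ ≤ Metric.infDist x F} :=
    calc μ {x | R ≤ Metric.infDist x F}
        = ∑ i, (p i : ENNReal) * μ (Φ.toMap i ⁻¹' {x | R ≤ Metric.infDist x F}) := by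
          conv_lhs => rw [hμp]
          rw [Measure.finsetSum_apply]
          refine Finset.sum_congr rfl fun i _ => ?_
          rw [Measure.smul_apply, Measure.map_apply (Φ.isClosedEmbedding_toMap i).measurable
            (measurableSet_le measurable_const hmeas), ENNReal.smul_def, smul_eq_mul]
      _ ≤ ∑ i, (p i : ENNReal) * μ {x | R / ρ ≤ Metric.infDist x F} := by
          gcongr with i
          exact hpre R i
      _ = μ {x | R / ρ ≤ Metric.infDist x F} := by
          rw [← Finset.sum_mul, ← ENNReal.ofNNReal_finsetSum, hp1, ENNReal.coe_one, one_mul]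
  filter_upwards [ae_le_zero_of_measure_le_measure_div hmeas hρ0 hρ1 fun R _ => hstep R] with x hx
  exact (hF.2.1.isClosed.mem_iff_infDist_zero hF.1).2 (hx.antisymm Metric.infDist_nonneg)

end SimilarityIFS

end SelfSimilarMeasures

section Slices

variable {μ : Measure Plane} [IsFiniteMeasure μ] {V : Submodule ℝ Plane} {F : Set Plane}

lemma sub_orthogonalProjectionOnto_orthogonal_mem {E : Type*} [NormedAddCommGroup E]
    [InnerProductSpace ℝ E] (V : Submodule ℝ E) [V.HasOrthogonalProjection] (x : E) :
    x - Vᗮ.orthogonalProjectionOnto x ∈ V := by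
  rw [Submodule.orthogonalProjectionOnto_orthogonal, sub_sub_cancel]
  exact V.starProjection_apply_mem x

instance isMarkovKernel_sliceMeasure : IsMarkovKernel (sliceMeasure μ V) := by
  unfold sliceMeasure
  infer_instance

lemma ae_ae_sliceMeasure (hF : MeasurableSet F) (hμF : ∀ᵐ x ∂μ, x ∈ F) :
    ∀ᵐ y ∂(μ.map Vᗮ.orthogonalProjectionOnto), ∀ᵐ x ∂(sliceMeasure μ V y),
      x ∈ F ∧ Vᗮ.orthogonalProjectionOnto x = y := by
  have hP : Measurable (Vᗮ.orthogonalProjectionOnto : Plane → Vᗮ) := by fun_prop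
  refine Measure.ae_ae_of_ae_compProd
    (p := fun q => q.2 ∈ F ∧ Vᗮ.orthogonalProjectionOnto q.2 = q.1) ?_
  rw [sliceMeasure, compProd_map_condDistrib aemeasurable_id, ae_map_iff]
  · simpa using hμF
  · exact (hP.prodMk measurable_id).aemeasurable
  · exact (measurable_snd hF).inter (measurableSet_eq_fun (hP.comp measurable_snd) measurable_fst)

lemma IsPorousAlong.not_isExactDimensional_one {ν : Measure Plane} [IsFiniteMeasure ν] [NeZero ν]
    {u : Plane} (hu : ‖u‖ = 1) {κ : ℝ} (hκ : 0 < κ)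
    (hF : IsPorousAlong (Submodule.span ℝ {u}) F κ) (hFb : Bornology.IsBounded F) {w : Plane}
    (hν : ∀ᵐ x ∂ν, x ∈ F ∧ ∃ t : ℝ, w + t • u = x) : ¬ IsExactDimensional ν 1 := by
  have hiso : Isometry fun t : ℝ => w + t • u := isometry_add_smul hu w
  obtain ⟨N, C, hN, hcov⟩ := (hF.setOf_add_smul_mem hu w).exists_externalCoveringNumber_le hκ
    (hiso.antilipschitz.isBounded_preimage hFb)
  have hNcast : ((N - 1 : ℕ) : ℝ) < N := mod_cast Nat.sub_lt (two_pos.trans_le hN) one_pos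
  refine not_isExactDimensional_of_externalCoveringNumber_le (b := N) (C := C) (M := N - 1)
    (K := (fun t : ℝ => w + t • u) '' {t | w + t • u ∈ F}) ?_ (mod_cast hN)
    (by simpa only [Real.rpow_one, NNReal.coe_natCast] using hNcast)
    fun n => (externalCoveringNumber_image_le_of_isometry hiso _).trans (hcov n)
  filter_upwards [hν]
  rintro _ ⟨hxF, t, rfl⟩
  exact ⟨t, hxF, rfl⟩

lemma ae_not_isExactDimensional_sliceMeasure {u : Plane} (hu : ‖u‖ = 1) {κ : ℝ} (hκ : 0 < κ)
    (hF : IsPorousAlong (Submodule.span ℝ {u}) F κ) (hFc : IsCompact F) (hμF : ∀ᵐ x ∂μ, x ∈ F) :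
    ∀ᵐ y ∂(μ.map (Submodule.span ℝ {u})ᗮ.orthogonalProjectionOnto),
      ¬ IsExactDimensional (sliceMeasure μ (Submodule.span ℝ {u}) y) 1 := by
  filter_upwards [ae_ae_sliceMeasure hFc.measurableSet hμF] with y hy
  refine hF.not_isExactDimensional_one hu hκ hFc.isBounded (w := y) ?_
  filter_upwards [hy]
  rintro x ⟨hxF, hxy⟩
  have hsub : x - y ∈ Submodule.span ℝ {u} :=
    hxy ▸ sub_orthogonalProjectionOnto_orthogonal_mem (Submodule.span ℝ {u}) x
  obtain ⟨t, ht⟩ := Submodule.mem_span_singleton.1 hsub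
  exact ⟨hxF, t, by rw [ht, add_sub_cancel]⟩

end Slices

theorem mainTheorem8_general {l : ℕ} (Φ : SimilarityIFS l) (μ : Measure Plane)
    [IsFiniteMeasure μ] [NeZero μ] :
    ((5 ≤ ENat.card Φ.orthGroup ∨
        2 < ENat.card (Φ.orthGroup ⊓ planeRotations : Subgroup PlaneOrthogonal)) →
      ¬ AdmitsOneSlicing Φ μ) ∧
    (∀ F, Φ.IsAttractor F →
      (∀ i j, i ≠ j → Disjoint (Φ.toMap i '' F) (Φ.toMap j '' F)) →
      (∀ᵐ x ∂μ, x ∈ F) → ¬ AdmitsOneSlicing Φ μ) := by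
  constructor
  · rintro hcard ⟨V, hV1, hV, -⟩
    have hle : Φ.orthGroup ≤ submoduleStabilizer V :=
      (Subgroup.closure_le _).2 (Set.range_subset_iff.2 hV)
    rcases hcard with hcard | hcard
    · have hle4 := (Set.encard_mono hle).trans
        (card_submoduleStabilizer_le_four finrank_euclideanSpace_fin hV1)
      exact absurd (hcard.trans hle4) (by decide)
    · exact hcard.not_ge ((Set.encard_mono (inf_le_inf_right planeRotations hle)).trans
        (card_submoduleStabilizer_inf_planeRotations_le_two hV1))
  · rintro F hF hdisj hμF ⟨V, hV1, hV, hdim⟩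
    obtain ⟨u, hu, rfl⟩ := exists_norm_eq_one_and_span_singleton_eq hV1
    have hspan : Submodule.span ℝ {u} ≠ ⊥ := Submodule.one_le_finrank_iff.1 hV1.ge
    obtain ⟨κ, hκ, hporous⟩ := hF.exists_isPorousAlong (fun i j => hdisj i j) hspan
      fun i v hv => (hV i).le (Submodule.mem_map_of_mem hv)
    have hmap : NeZero (μ.map (Submodule.span ℝ {u})ᗮ.orthogonalProjectionOnto) :=
      ⟨(Measure.map_ne_zero_iff (by fun_prop)).2 (NeZero.ne μ)⟩
    obtain ⟨y, hy, hy'⟩ := (hdim.and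
      (ae_not_isExactDimensional_sliceMeasure hu hκ hporous hF.2.1 hμF)).exists
    exact hy' hy

theorem mainTheorem8 {l : ℕ} (Φ : SimilarityIFS l) (μ : MeasureTheory.Measure Plane)
    [MeasureTheory.IsProbabilityMeasure μ] (hμ : Φ.IsSelfSimilarMeasure μ) :
    ((5 ≤ ENat.card Φ.orthGroup ∨
        2 < ENat.card (Φ.orthGroup ⊓ planeRotations : Subgroup PlaneOrthogonal)) →
      ¬ AdmitsOneSlicing Φ μ) ∧
    (Φ.SSC → ¬ AdmitsOneSlicing Φ μ) :=
  ⟨(mainTheorem8_general Φ μ).1, fun ⟨F, hF, hdisj⟩ =>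
    (mainTheorem8_general Φ μ).2 F hF hdisj (hμ.ae_mem_attractor hF)⟩
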